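/- Let $\mathcal H$ be a separable infinite-dimensional complex Hilbert space, $d\ge 0$ an integer, and let $B(\mathcal H)^d$ be the space of $d$-tuples $x=(x^1,\dots,x^d)$ of bounded operators on $\mathcal H$, with the norm topology. For $x,y\in B(\mathcal H)^d$ and $T\in B(\mathcal H)$ write $Tx=(Tx^1,\dots,Tx^d)$, $yT=(y^1T,\dots,y^dT)$; direct sums and conjugations of $d$-tuples are likewise taken coordinatewise. A free polynomial is a complex linear combination of words (the empty word included) in $d$ non-commuting variables; it is homogeneous of degree $k$ if it is a linear combination of words of length $k$ (so $0$ is homogeneous of every degree). Let $D\subseteq B(\mathcal H)^d$ be open, balanced ($\alpha x\in D$ whenever $x\in D$ and $\alpha\in\mathbb C$, $|\alpha|\le 1$), and closed with respect to countable direct sums: for every bounded sequence $x_1,x_2,\dots$ in $D$ there is a unitary $u:\mathcal H\to\mathcal H\oplus\mathcal H\oplus\cdots$ with $u^*(x_1\oplus x_2\oplus\cdots)u\in D$. Let $F:D\to B(\mathcal H)$. Then the following are equivalent. (i) $F$ is intertwining preserving and sequentially strong-operator continuous. Here *intertwining preserving* means: (a) whenever $x,y\in D$, $T\in B(\mathcal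 H)$ and $Tx=yT$, then $TF(x)=F(y)T$; and (b) whenever $(x_n)$ is a bounded (finite or infinite) sequence in $D$ and $s:\mathcal H\to\bigoplus_n\mathcal H$ is an invertible bounded operator with $s^{-1}\big(\bigoplus_n x_n\big)s\in D$, then $(F(x_n))$ is bounded and $F\big(s^{-1}\big(\bigoplus_n x_n\big)s\big)=s^{-1}\big(\bigoplus_n F(x_n)\big)s$. *Sequentially strong-operator continuous* means: whenever $x_n,x\in D$ and $x_n\to x$ in the strong operator topology (coordinatewise), then $F(x_n)\to F(x)$ in the strong operator topology. (ii) There are free polynomials $P_0,P_1,P_2,\dots$, with $P_k$ homogeneous of degree $k$, such that for each $x\in D$ the series $\sum_{k=0}^\infty P_k(x)$ converges absolutely (i.e. $\sum_k\|P_k(x)\|<\infty$) with sum $F(x)$. (iii) $F$ is uniformly approximable by free polynomials on finite subsets of $D$: for every finite $S\subseteq D$ and every $\varepsilon>0$ there is a free polynomial $p$ with $\|p(x)-F(x)\|<\varepsilon$ for all $x\in S$. -/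

import Mathlib

open scoped Topology ENNReal

namespace FreeIP

variable {H : Type*} [NormedAddCommGroup H] [InnerProductSpace ℂ H]

/-- The Hilbert space direct sum of copies of `H` indexed by `ι`. -/
abbrev HSum (ι : Type) (H : Type*) [NormedAddCommGroup H] [InnerProductSpace ℂ H] : Type _ :=
  lp (fun _ : ι => H) 2

/-- For a norm-bounded family `T` of operators on `H` and an invertible bounded operator
`s : H → ⊕ H`, the operator `s⁻¹ (⊕ₙ Tₙ) s` on `H`. The bound only serves to make `⊕ₙ Tₙ` a bounded
operator; the result does not depend on its value. -/
noncomputable def conjDirectSum {ι : Type} (s : H ≃L[ℂ] HSum ι H) (T : ι → (H →L[ℂ] H))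
    {C : ℝ} (hC : 0 ≤ C) (hT : ∀ n, ‖T n‖ ≤ C) : H →L[ℂ] H :=
  (s.symm : HSum ι H →L[ℂ] H) ∘L lp.mapCLM 2 T hC hT ∘L (s : H →L[ℂ] HSum ι H)

/-- `D ⊆ B(H)^d` is closed with respect to countable direct sums: for every bounded sequence
`x₁, x₂, …` in `D` there is a unitary `u : H → H ⊕ H ⊕ ⋯` with `u* (x₁ ⊕ x₂ ⊕ ⋯) u ∈ D`. -/
def ClosedUnderCountableDirectSums {d : ℕ} (D : Set (Fin d → (H →L[ℂ] H))) : Prop :=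
  ∀ (x : ℕ → D) (C : ℝ) (hC : 0 ≤ C) (hx : ∀ i n, ‖(x n).1 i‖ ≤ C),
    ∃ u : H ≃ₗᵢ[ℂ] HSum ℕ H,
      (fun i => conjDirectSum u.toContinuousLinearEquiv (fun n => (x n).1 i) hC (hx i)) ∈ D

/-- Intertwining preserving functions. In `map_directSum` the sequences are indexed by an arbitrary
countable type, so that finite and infinite sequences are both covered; the conclusion includes that
the sequence `F (xₙ)` is bounded, so that `⊕ₙ F (xₙ)` makes sense. -/
structure IntertwiningPreserving {d : ℕ} {D : Set (Fin d → (H →L[ℂ] H))}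
    (F : D → (H →L[ℂ] H)) : Prop where
  map_intertwine : ∀ (x y : D) (T : H →L[ℂ] H),
    (∀ i, T * x.1 i = y.1 i * T) → T * F x = F y * T
  map_directSum : ∀ (ι : Type) [Countable ι] (x : ι → D) (C : ℝ) (hC : 0 ≤ C)
    (hx : ∀ i n, ‖(x n).1 i‖ ≤ C) (s : H ≃L[ℂ] HSum ι H) (y : D),
    (∀ i, y.1 i = conjDirectSum s (fun n => (x n).1 i) hC (hx i)) →
    ∃ (K : ℝ) (hK : 0 ≤ K) (hF : ∀ n, ‖F (x n)‖ ≤ K),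
      F y = conjDirectSum s (fun n => F (x n)) hK hF

/-- Sequential continuity with respect to the strong operator topologies. -/
def SeqStrongOperatorContinuous {d : ℕ} {D : Set (Fin d → (H →L[ℂ] H))}
    (F : D → (H →L[ℂ] H)) : Prop :=
  ∀ (x : ℕ → D) (y : D),
    (∀ (i : Fin d) (v : H), Filter.Tendsto (fun n => (x n).1 i v) Filter.atTop (𝓝 (y.1 i v))) →
    ∀ v : H, Filter.Tendsto (fun n => F (x n) v) Filter.atTop (𝓝 (F y v))

/-- Free polynomials in `d` variables: complex linear combinations of words, the empty word
included. -/
abbrev FreePoly (d : ℕ) : Type := FreeAlgebra ℂ (Fin d)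

/-- The value of a free polynomial at a `d`-tuple of operators. -/
noncomputable def FreePoly.evalOp {d : ℕ} (p : FreePoly d) (x : Fin d → (H →L[ℂ] H)) :
    H →L[ℂ] H :=
  FreeAlgebra.lift ℂ x p

/-- `p` is homogeneous of degree `k`: a linear combination of words of length exactly `k`
(so `0` is homogeneous of every degree). -/
def FreePoly.IsHomogeneousOfDegree {d : ℕ} (p : FreePoly d) (k : ℕ) : Prop :=
  p ∈ Submodule.span ℂ (Set.range fun w : Fin k → Fin d =>
    (List.ofFn fun j => FreeAlgebra.ι ℂ (w j)).prod)

/-- There are homogeneous free polynomials `P k` of degree `k`, `k = 0, 1, …`, such that `∑ P k (x)`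
converges absolutely to `F x` at each `x ∈ D`. -/
def HasFreePowerSeries {d : ℕ} {D : Set (Fin d → (H →L[ℂ] H))} (F : D → (H →L[ℂ] H)) : Prop :=
  ∃ P : ℕ → FreePoly d, (∀ k, FreePoly.IsHomogeneousOfDegree (P k) k) ∧
    ∀ x : D, Summable (fun k => ‖FreePoly.evalOp (P k) x.1‖) ∧
      HasSum (fun k => FreePoly.evalOp (P k) x.1) (F x)

/-- `F` is uniformly approximable by free polynomials on finite subsets of `D`. -/
def ApproximableOnFiniteSets {d : ℕ} {D : Set (Fin d → (H →L[ℂ] H))}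
    (F : D → (H →L[ℂ] H)) : Prop :=
  ∀ (S : Finset D) (ε : ℝ), 0 < ε → ∃ p : FreePoly d, ∀ x ∈ S, ‖FreePoly.evalOp p x.1 - F x‖ < ε

end FreeIP

/-! An intertwining identity forces a function to be a power series. If `L` is the tuple of left
creation operators on Fock space, embedded in `H`, then for small `x` and any `v` the operator
sending the basis vector of a word `w` to `r^(-|w|) x^w v` intertwines `r • L` with `x`. Hence `F (r
• L)` applied to the vacuum determines `F x v`: its components are, up to powers of `r`, the
coefficients of a free series for `F` near `0` (`exists_coeff`).

To reach all of `D`, restrict to lines: `ζ ↦ F (ζ • x)` is holomorphic on a disc of radius greater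
than `1`, so its Taylor series, whose terms are `ζ^k P_k(x)` by uniqueness, converges absolutely at
`ζ = 1`. Holomorphy comes from direct sums, which make `F` bounded on bounded sets, and from upper
triangular block tuples, at which the corner of `F` is a multiple of a difference of values
(`exists_upperTriangular`).

Conversely, polynomials respect intertwiners, and this survives approximation at two points. Strong
continuity follows by approximating at the direct sum of a sequence, which controls all its terms at
once. -/

namespace FreeIP

/-! ### Free polynomials and intertwiners -/

section Basic

variable {H : Type*} [NormedAddCommGroup H] [InnerProductSpace ℂ H] {d : ℕ}

/-- Values of a free polynomial at intertwined tuples are intertwined. -/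
theorem FreePoly.mul_evalOp {x y : Fin d → (H →L[ℂ] H)} {T : H →L[ℂ] H}
    (h : ∀ i, T * x i = y i * T) (p : FreePoly d) : T * p.evalOp x = p.evalOp y * T := by
  induction p using FreeAlgebra.induction with
  | grade0 c =>
    simp only [FreePoly.evalOp, AlgHom.commutes]
    exact (Algebra.commutes c T).symm
  | grade1 i => simpa [FreePoly.evalOp] using h i
  | mul a b ha hb =>
    simp only [FreePoly.evalOp, map_mul] at ha hb ⊢
    rw [← mul_assoc, ha, mul_assoc, hb, mul_assoc]
  | add a b ha hb =>
    simp only [FreePoly.evalOp, map_add] at ha hb ⊢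
    rw [mul_add, add_mul, ha, hb]

/-- Evaluation of free polynomials is sequentially strong-operator continuous. -/
theorem FreePoly.tendsto_evalOp_apply [CompleteSpace H] {x : ℕ → Fin d → (H →L[ℂ] H)}
    {y : Fin d → (H →L[ℂ] H)}
    (h : ∀ i v, Filter.Tendsto (fun n => x n i v) Filter.atTop (𝓝 (y i v))) {C : ℝ}
    (hC : ∀ i n, ‖x n i‖ ≤ C) (p : FreePoly d) (v : H) :
    Filter.Tendsto (fun n => p.evalOp (x n) v) Filter.atTop (𝓝 (p.evalOp y v)) := by
  -- The norm bound is carried through the induction because strong limits of products need the left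
  -- factors to be uniformly bounded.
  have key : (∃ K, ∀ n, ‖p.evalOp (x n)‖ ≤ K) ∧
      ∀ v, Filter.Tendsto (fun n => p.evalOp (x n) v) Filter.atTop (𝓝 (p.evalOp y v)) := by
    induction p using FreeAlgebra.induction with
    | grade0 c =>
      simp only [FreePoly.evalOp, AlgHom.commutes]
      exact ⟨⟨_, fun _ => le_rfl⟩, fun v => tendsto_const_nhds⟩
    | grade1 i => simpa [FreePoly.evalOp] using ⟨⟨C, hC i⟩, h i⟩
    | mul a b ha hb =>
      obtain ⟨⟨K, hK⟩, ha⟩ := ha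
      obtain ⟨⟨K', hK'⟩, hb⟩ := hb
      simp only [FreePoly.evalOp, map_mul] at ha hb hK hK' ⊢
      refine ⟨⟨K * K', fun n => (norm_mul_le _ _).trans (mul_le_mul (hK n) (hK' n)
        (norm_nonneg _) ((norm_nonneg _).trans (hK n)))⟩, fun v => ?_⟩
      rw [tendsto_iff_norm_sub_tendsto_zero]
      have h1 := (tendsto_iff_norm_sub_tendsto_zero.1 (hb v)).const_mul K
      have h2 := tendsto_iff_norm_sub_tendsto_zero.1 (ha ((FreeAlgebra.lift ℂ y) b v))
      have h3 := h1.add h2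
      rw [mul_zero, add_zero] at h3
      refine squeeze_zero (fun _ => norm_nonneg _) (fun n => ?_) h3
      refine le_trans ?_ (add_le_add_left (ContinuousLinearMap.le_of_opNorm_le _ (hK n) _) _)
      refine le_trans (le_of_eq ?_) (norm_add_le _ _)
      simp
    | add a b ha hb =>
      obtain ⟨⟨K, hK⟩, ha⟩ := ha
      obtain ⟨⟨K', hK'⟩, hb⟩ := hb
      simp only [FreePoly.evalOp, map_add] at ha hb hK hK' ⊢
      exact ⟨⟨K + K', fun n => (norm_add_le _ _).trans (add_le_add (hK n) (hK' n))⟩,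
        fun v => (ha v).add (hb v)⟩
  exact key.2 v

/-! ### Coordinates of direct sums -/

/-- The `n`-th coordinate of `s`, as an operator on `H`. -/
noncomputable def coordOp {ι : Type} (s : H ≃L[ℂ] HSum ι H) (n : ι) : H →L[ℂ] H :=
  lp.evalCLM ℂ (fun _ : ι => H) 2 n ∘L (s : H →L[ℂ] HSum ι H)

open Classical in
/-- The embedding of the `n`-th summand, as an operator on `H`. -/
noncomputable def summandOp {ι : Type} (s : H ≃L[ℂ] HSum ι H) (n : ι) : H →L[ℂ] H :=
  (s.symm : HSum ι H →L[ℂ] H) ∘L lp.singleContinuousLinearMap ℂ (fun _ : ι => H) 2 n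

theorem coordOp_apply {ι : Type} (s : H ≃L[ℂ] HSum ι H) (n : ι) (v : H) :
    coordOp s n v = s v n := rfl

open Classical in
theorem summandOp_apply {ι : Type} (s : H ≃L[ℂ] HSum ι H) (n : ι) (v : H) :
    summandOp s n v = s.symm (lp.single 2 n v) := rfl

theorem coordOp_mul_summandOp_self {ι : Type} (s : H ≃L[ℂ] HSum ι H) (n : ι) :
    coordOp s n * summandOp s n = 1 := by
  ext v
  simp [coordOp_apply, summandOp_apply]

theorem coordOp_mul_summandOp_of_ne {ι : Type} (s : H ≃L[ℂ] HSum ι H) {m n : ι} (h : m ≠ n) :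
    coordOp s m * summandOp s n = 0 := by
  ext v
  simp [coordOp_apply, summandOp_apply, h]

/-- An operator into a direct sum is determined by its coordinates. This turns a direct sum
condition into a family of intertwining conditions. -/
theorem eq_conjDirectSum_iff {ι : Type} (s : H ≃L[ℂ] HSum ι H) (T : ι → (H →L[ℂ] H)) {C : ℝ}
    (hC : 0 ≤ C) (hT : ∀ n, ‖T n‖ ≤ C) (A : H →L[ℂ] H) :
    A = conjDirectSum s T hC hT ↔ ∀ n, coordOp s n * A = T n * coordOp s n := by
  constructor
  · rintro rfl n
    ext v
    simp [coordOp_apply, conjDirectSum]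
  · intro h
    ext v
    apply s.injective
    apply lp.ext
    funext n
    simpa [coordOp_apply, conjDirectSum] using
      congrArg (fun B : H →L[ℂ] H => B v) (h n)

theorem conjDirectSum_mul_summandOp {ι : Type} (s : H ≃L[ℂ] HSum ι H) (T : ι → (H →L[ℂ] H))
    {C : ℝ} (hC : 0 ≤ C) (hT : ∀ n, ‖T n‖ ≤ C) (n : ι) :
    conjDirectSum s T hC hT * summandOp s n = summandOp s n * T n := by
  classical
  ext v
  apply s.injective
  apply lp.ext
  funext m
  by_cases h : m = n
  · subst h
    simp [summandOp_apply, conjDirectSum]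
  · simp [summandOp_apply, conjDirectSum, h]

theorem norm_summandOp_le {ι : Type} (u : H ≃ₗᵢ[ℂ] HSum ι H) (n : ι) :
    ‖summandOp u.toContinuousLinearEquiv n‖ ≤ 1 := by
  classical
  refine ContinuousLinearMap.opNorm_le_bound _ zero_le_one fun v => ?_
  rw [summandOp_apply, one_mul]
  exact ((u.symm.norm_map _).trans (lp.norm_single (by norm_num) n v)).le

theorem norm_coordOp_le {ι : Type} (u : H ≃ₗᵢ[ℂ] HSum ι H) (n : ι) :
    ‖coordOp u.toContinuousLinearEquiv n‖ ≤ 1 := by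
  refine ContinuousLinearMap.opNorm_le_bound _ zero_le_one fun v => ?_
  rw [coordOp_apply, one_mul]
  exact (lp.norm_apply_le_norm (by norm_num) (u v) n).trans (u.norm_map v).le

variable {D : Set (Fin d → (H →L[ℂ] H))}

/-- Preservation of direct sums is a consequence of preservation of intertwiners. -/
theorem IntertwiningPreserving.of_map_intertwine {F : D → (H →L[ℂ] H)}
    (h : ∀ (x y : D) (T : H →L[ℂ] H), (∀ i, T * x.1 i = y.1 i * T) → T * F x = F y * T) :
    IntertwiningPreserving F := by
  refine ⟨h, fun ι _ x C hC hx s y hy => ?_⟩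
  classical
  have h1 : ∀ n, coordOp s n * F y = F (x n) * coordOp s n := fun n =>
    h y (x n) _ fun i => (eq_conjDirectSum_iff s _ hC (hx i) _).1 (hy i) n
  have h2 : ∀ n, F (x n) = coordOp s n * F y * summandOp s n := fun n => by
    rw [h1, mul_assoc, coordOp_mul_summandOp_self, mul_one]
  -- Each `F (x n)` is a compression of the single operator `F y`, so one bound serves all `n`.
  have h3 : ∀ n, ‖F (x n)‖ ≤
      ‖(s : H →L[ℂ] HSum ι H)‖ * ‖F y‖ * ‖(s.symm : HSum ι H →L[ℂ] H)‖ := fun n => by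
    refine ContinuousLinearMap.opNorm_le_bound _ (by positivity) fun v => ?_
    rw [h2 n, mul_apply_eq_comp, mul_apply_eq_comp, coordOp_apply,
      summandOp_apply]
    refine (lp.norm_apply_le_norm (by norm_num) _ n).trans ?_
    refine ((s : H →L[ℂ] HSum ι H).le_opNorm _).trans ?_
    rw [mul_assoc, mul_assoc]
    refine mul_le_mul_of_nonneg_left ?_ (norm_nonneg _)
    refine ((F y).le_opNorm _).trans (mul_le_mul_of_nonneg_left ?_ (norm_nonneg _))
    refine ((s.symm : HSum ι H →L[ℂ] H).le_opNorm _).trans (le_of_eq ?_)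
    rw [lp.norm_single (by norm_num)]
  exact ⟨_, by positivity, h3, (eq_conjDirectSum_iff s _ _ h3 _).2 h1⟩

/-! ### Consequences of polynomial approximation -/

theorem HasFreePowerSeries.approximableOnFiniteSets {F : D → (H →L[ℂ] H)}
    (h : HasFreePowerSeries F) : ApproximableOnFiniteSets F := by
  obtain ⟨P, -, hP⟩ := h
  intro S ε hε
  have h1 : ∀ x ∈ S, ∀ᶠ N in Filter.atTop,
      ‖FreePoly.evalOp (∑ k ∈ Finset.range N, P k) x.1 - F x‖ < ε := fun x _ => by
    have := (hP x).2.tendsto_sum_nat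
    filter_upwards [Metric.tendsto_nhds.1 this ε hε] with N hN
    simpa [FreePoly.evalOp, dist_eq_norm, map_sum] using hN
  obtain ⟨N, hN⟩ := ((Filter.eventually_all_finset S).2 h1).exists
  exact ⟨_, hN⟩

theorem ApproximableOnFiniteSets.map_intertwine {F : D → (H →L[ℂ] H)}
    (h : ApproximableOnFiniteSets F) (x y : D) (T : H →L[ℂ] H)
    (hT : ∀ i, T * x.1 i = y.1 i * T) : T * F x = F y * T := by
  classical
  rw [← sub_eq_zero, ← norm_le_zero_iff]
  refine le_of_forall_pos_le_add fun ε hε => ?_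
  obtain ⟨p, hp⟩ := h {x, y} (ε / (2 * (‖T‖ + 1))) (by positivity)
  have h1 := (hp x (by simp)).le
  have h2 := (hp y (by simp)).le
  have h3 : T * F x - F y * T = (p.evalOp y.1 - F y) * T - T * (p.evalOp x.1 - F x) := by
    rw [mul_sub, sub_mul, FreePoly.mul_evalOp hT]
    abel
  have h4 : ‖(p.evalOp y.1 - F y) * T‖ ≤ ε / (2 * (‖T‖ + 1)) * (‖T‖ + 1) :=
    (norm_mul_le _ _).trans (mul_le_mul h2 (by linarith) (norm_nonneg _) (by positivity))
  have h5 : ‖T * (p.evalOp x.1 - F x)‖ ≤ (‖T‖ + 1) * (ε / (2 * (‖T‖ + 1))) :=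
    (norm_mul_le _ _).trans (mul_le_mul (by linarith) h1 (norm_nonneg _) (by positivity))
  have h6 : ε / (2 * (‖T‖ + 1)) * (‖T‖ + 1) = ε / 2 := by
    have : ‖T‖ + 1 ≠ 0 := by positivity
    field_simp
  rw [h3]
  refine (norm_sub_le _ _).trans ?_
  rw [mul_comm] at h5
  linarith

/-- A strongly convergent sequence is bounded, so its direct sum is unitarily equivalent to some `z`
in `D`. One polynomial close to `F` at `z` and at the limit is equally close at every term, and
polynomials are strongly continuous on bounded sequences. -/
theorem ApproximableOnFiniteSets.seqStrongOperatorContinuous [CompleteSpace H]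
    (hsum : ClosedUnderCountableDirectSums D) {F : D → (H →L[ℂ] H)}
    (h : ApproximableOnFiniteSets F) : SeqStrongOperatorContinuous F := by
  classical
  intro x y hxy v
  have hb : ∀ i, ∃ C, ∀ n, ‖(x n).1 i‖ ≤ C := fun i => by
    refine banach_steinhaus fun w => ?_
    obtain ⟨C, hC⟩ := (hxy i w).norm.bddAbove_range
    exact ⟨C, fun n => hC ⟨n, rfl⟩⟩
  choose c hc using hb
  obtain ⟨C, hC, hx⟩ : ∃ C : ℝ, 0 ≤ C ∧ ∀ i n, ‖(x n).1 i‖ ≤ C :=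
    ⟨∑ i, |c i|, by positivity, fun i n => (hc i n).trans ((le_abs_self _).trans
      (Finset.single_le_sum (f := fun i => |c i|) (fun _ _ => abs_nonneg _)
        (Finset.mem_univ i)))⟩
  obtain ⟨u, hu⟩ := hsum x C hC hx
  set s := u.toContinuousLinearEquiv
  let z : D := ⟨_, hu⟩
  have hz : ∀ n i, coordOp s n * z.1 i = (x n).1 i * coordOp s n := fun n i =>
    (eq_conjDirectSum_iff s _ hC (hx i) _).1 rfl n
  rw [Metric.tendsto_atTop']
  intro ε hε
  obtain ⟨p, hp⟩ := h {z, y} (ε / (3 * (‖v‖ + 1))) (by positivity)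
  have hεv : ε / (3 * (‖v‖ + 1)) * ‖v‖ ≤ ε / 3 := by
    rw [div_mul_eq_mul_div, div_le_div_iff₀ (by positivity) (by positivity)]
    nlinarith [norm_nonneg v]
  have hpx : ∀ n, ‖(p.evalOp (x n).1 - F (x n)) v‖ ≤ ε / 3 := fun n => by
    -- The error at `x n` is a compression of the error at `z` by contractions, as `u` is unitary.
    have h1 : p.evalOp (x n).1 - F (x n) =
        coordOp s n * (p.evalOp z.1 - F z) * summandOp s n := by
      rw [mul_sub, FreePoly.mul_evalOp (hz n), h.map_intertwine z (x n) _ (hz n), ← sub_mul,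
        mul_assoc, coordOp_mul_summandOp_self, mul_one]
    refine (ContinuousLinearMap.le_of_opNorm_le _ ?_ v).trans hεv
    rw [h1]
    refine (norm_mul_le _ _).trans ?_
    refine (mul_le_mul (norm_mul_le _ _) (norm_summandOp_le u n) (norm_nonneg _)
      (by positivity)).trans ?_
    rw [mul_one]
    refine (mul_le_mul_of_nonneg_right (norm_coordOp_le u n) (norm_nonneg _)).trans ?_
    rw [one_mul]
    exact (hp z (by simp)).le
  have hpy : ‖(p.evalOp y.1 - F y) v‖ ≤ ε / 3 :=
    (ContinuousLinearMap.le_of_opNorm_le _ (hp y (by simp)).le v).trans hεv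
  obtain ⟨N, hN⟩ := Metric.tendsto_atTop'.1 (FreePoly.tendsto_evalOp_apply hxy hx p v) (ε / 3)
    (by positivity)
  refine ⟨N, fun n hn => ?_⟩
  have h2 := hN n hn
  rw [dist_eq_norm] at h2 ⊢
  have h3 : F (x n) v - F y v = (p.evalOp (x n).1 v - p.evalOp y.1 v) -
      (p.evalOp (x n).1 - F (x n)) v + (p.evalOp y.1 - F y) v := by
    simp only [sub_apply]
    abel
  rw [h3]
  have h4 := norm_add_le ((p.evalOp (x n).1 v - p.evalOp y.1 v) -
      (p.evalOp (x n).1 - F (x n)) v) ((p.evalOp y.1 - F y) v)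
  have h5 := norm_sub_le (p.evalOp (x n).1 v - p.evalOp y.1 v) ((p.evalOp (x n).1 - F (x n)) v)
  linarith [hpx n]

end Basic

/-! ### Words and homogeneous polynomials -/

/-- Words in `d` letters. -/
abbrev Word (d : ℕ) : Type := Σ k : ℕ, (Fin k → Fin d)

namespace Word

variable {d : ℕ}

/-- Prepend a letter to a word. -/
def cons (i : Fin d) (w : Word d) : Word d := ⟨w.1 + 1, Fin.cons i w.2⟩

theorem cons_injective (i : Fin d) : Function.Injective (cons i) := by
  rintro ⟨k, w⟩ ⟨l, w'⟩ h
  simp only [cons, Sigma.mk.injEq, add_left_inj] at h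
  obtain ⟨rfl, h⟩ := h
  rw [heq_eq_eq, Fin.cons_right_injective _ |>.eq_iff] at h
  rw [h]

/-- The product of the letters of `w` substituted by `x`. -/
def eval {A : Type*} [Monoid A] (x : Fin d → A) (w : Word d) : A :=
  (List.ofFn fun j => x (w.2 j)).prod

theorem eval_cons {A : Type*} [Monoid A] (x : Fin d → A) (i : Fin d) (w : Word d) :
    eval x (cons i w) = x i * eval x w := by
  simp [eval, cons, List.ofFn_succ]

theorem map_eval {A B : Type*} [Monoid A] [Monoid B] (f : A →* B) (x : Fin d → A) (w : Word d) :
    f (eval x w) = eval (fun i => f (x i)) w := by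
  simp only [eval, map_list_prod, List.map_ofFn]
  rfl

theorem norm_eval_le {A : Type*} [NormedRing A] [NormOneClass A] (x : Fin d → A) (w : Word d) :
    ‖eval x w‖ ≤ ‖x‖ ^ w.1 := by
  obtain ⟨k, w⟩ := w
  induction k with
  | zero => simp [eval]
  | succ k ih =>
    rw [← Fin.cons_self_tail w]
    have h := eval_cons x (w 0) ⟨k, Fin.tail w⟩
    rw [cons] at h
    rw [h, pow_succ']
    exact (norm_mul_le _ _).trans (mul_le_mul (norm_le_pi_norm x _) (ih _) (norm_nonneg _)
      (norm_nonneg _))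

/-- There are `d ^ k` words of length `k`, so grouping by length gives a geometric series of ratio
`d * t`. -/
theorem summable_pow {t : ℝ} (ht : 0 ≤ t) (h : d * t < 1) :
    Summable fun w : Word d => t ^ w.1 := by
  rw [summable_sigma_of_nonneg fun w => by positivity]
  refine ⟨fun k => Summable.of_finite, ?_⟩
  simp only [tsum_fintype, Finset.sum_const, Finset.card_univ, Fintype.card_fun, Fintype.card_fin,
    nsmul_eq_mul, Nat.cast_pow, ← mul_pow]
  exact summable_geometric_of_lt_one (by positivity) h

end Word

/-- The free polynomial of degree `k` with coefficients `a`. -/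
noncomputable def FreePoly.ofCoeff {d : ℕ} (a : Word d → ℂ) (k : ℕ) : FreePoly d :=
  ∑ w : Fin k → Fin d, a ⟨k, w⟩ • Word.eval (FreeAlgebra.ι ℂ) ⟨k, w⟩

theorem FreePoly.isHomogeneousOfDegree_ofCoeff {d : ℕ} (a : Word d → ℂ) (k : ℕ) :
    (FreePoly.ofCoeff a k).IsHomogeneousOfDegree k :=
  Submodule.sum_mem _ fun w _ => Submodule.smul_mem _ _ (Submodule.subset_span ⟨w, rfl⟩)

/-! ### Fock space and the expansion near the origin -/

section Fock

variable {H : Type*} [NormedAddCommGroup H] [InnerProductSpace ℂ H] {d : ℕ}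

theorem FreePoly.evalOp_ofCoeff (a : Word d → ℂ) (k : ℕ) (x : Fin d → (H →L[ℂ] H)) :
    (FreePoly.ofCoeff a k).evalOp x = ∑ w : Fin k → Fin d, a ⟨k, w⟩ • Word.eval x ⟨k, w⟩ := by
  simp only [FreePoly.evalOp, FreePoly.ofCoeff, map_sum, map_smul]
  refine Finset.sum_congr rfl fun w _ => ?_
  congr 1
  have := Word.map_eval ((FreeAlgebra.lift ℂ x : FreePoly d →ₐ[ℂ] (H →L[ℂ] H)) :
    FreePoly d →* (H →L[ℂ] H)) (FreeAlgebra.ι ℂ) ⟨k, w⟩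
  simpa using this

theorem FreePoly.evalOp_ofCoeff_smul (a : Word d → ℂ) (k : ℕ) (c : ℂ)
    (x : Fin d → (H →L[ℂ] H)) :
    (FreePoly.ofCoeff a k).evalOp (c • x) = c ^ k • (FreePoly.ofCoeff a k).evalOp x := by
  have h : ∀ w : Word d, Word.eval (c • x) w = c ^ w.1 • Word.eval x w := by
    rintro ⟨k, w⟩
    induction k with
    | zero => simp [Word.eval]
    | succ k ih =>
      rw [← Fin.cons_self_tail w]
      have h := fun y : Fin d → (H →L[ℂ] H) => Word.eval_cons y (w 0) ⟨k, Fin.tail w⟩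
      simp only [Word.cons] at h
      rw [h, h, ih, pow_succ', Pi.smul_apply, smul_mul_smul_comm]
  simp only [FreePoly.evalOp_ofCoeff, h, Finset.smul_sum]
  exact Finset.sum_congr rfl fun w _ => smul_comm _ _ _

theorem exists_orthonormal [CompleteSpace H] (hH : ¬ FiniteDimensional ℂ H) (ι : Type*)
    [Countable ι] : ∃ v : ι → H, Orthonormal ℂ v := by
  obtain ⟨s, b, -⟩ := exists_hilbertBasis ℂ H
  have : Infinite s := by
    by_contra hs
    rw [not_infinite_iff_finite] at hs
    have := Fintype.ofFinite s
    exact hH b.toOrthonormalBasis.toBasis.finiteDimensional_of_finite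
  obtain ⟨g, hg⟩ := exists_injective_nat ι
  exact ⟨_, b.orthonormal.comp _ ((Infinite.natEmbedding s).injective.comp hg)⟩

/-- A summable family of vectors gives an operator sending the standard basis to it. -/
theorem exists_operator_of_summable [CompleteSpace H] {ι : Type*} {f : ι → H}
    (hf : Summable fun j => ‖f j‖) :
    ∃ T : lp (fun _ : ι => ℂ) 2 →L[ℂ] H, ∀ u, HasSum (fun j => u j • f j) (T u) := by
  have h : Summable fun j => (lp.evalCLM ℂ (fun _ : ι => ℂ) 2 j).smulRight (f j) := by
    refine Summable.of_norm_bounded hf fun j => ?_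
    refine ContinuousLinearMap.opNorm_le_bound _ (norm_nonneg _) fun u => ?_
    rw [ContinuousLinearMap.smulRight_apply, norm_smul, mul_comm]
    exact mul_le_mul_of_nonneg_left (lp.norm_apply_le_norm (by norm_num) u j) (norm_nonneg _)
  exact ⟨∑' j, (lp.evalCLM ℂ (fun _ : ι => ℂ) 2 j).smulRight (f j), fun u =>
    h.hasSum.mapL (ContinuousLinearMap.apply ℂ H u)⟩

/-- The isometry of `ℓ²` permuting the standard basis along an injection. -/
theorem exists_shift {ι : Type*} [DecidableEq ι] {g : ι → ι} (hg : Function.Injective g) :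
    ∃ S : lp (fun _ : ι => ℂ) 2 →L[ℂ] lp (fun _ : ι => ℂ) 2,
      ∀ j c, S (lp.single 2 j c) = lp.single 2 (g j) c := by
  let b : HilbertBasis ι ℂ (lp (fun _ : ι => ℂ) 2) := ⟨LinearIsometryEquiv.refl ℂ _⟩
  have hb : Orthonormal ℂ (b ∘ g) := b.orthonormal.comp g hg
  refine ⟨hb.orthogonalFamily.linearIsometry.toContinuousLinearMap, fun j c => ?_⟩
  rw [LinearIsometry.coe_toContinuousLinearMap, OrthogonalFamily.linearIsometry_apply_single,
    LinearIsometry.toSpanSingleton_apply]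
  have : b (g j) = lp.single 2 (g j) (1 : ℂ) := (b.repr_symm_single (g j)).symm
  rw [Function.comp_apply, this, ← lp.single_smul, smul_eq_mul, mul_one]

/-- Evaluation at a scaled tuple of creation operators gives a norm-convergent expansion near the
origin, with coefficients not depending on the point. -/
theorem IntertwiningPreserving.exists_coeff [CompleteSpace H] (hH : ¬ FiniteDimensional ℂ H)
    {D : Set (Fin d → (H →L[ℂ] H))} {F : D → (H →L[ℂ] H)} (hF : IntertwiningPreserving F)
    (hD : D ∈ 𝓝 0) :
    ∃ (a : Word d → ℂ) (ρ : ℝ), 0 < ρ ∧ ∀ x : D, ‖x.1‖ < ρ →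
      HasSum (fun w => a w • Word.eval x.1 w) (F x) := by
  classical
  obtain ⟨e, he⟩ := exists_orthonormal hH (Word d)
  let V := he.orthogonalFamily.linearIsometry.toContinuousLinearMap
  let V' := ContinuousLinearMap.adjoint V
  have hV : ∀ u, V' (V u) = u := fun u => by
    have := congrArg (fun A : lp (fun _ : Word d => ℂ) 2 →L[ℂ] lp (fun _ : Word d => ℂ) 2 => A u)
      (LinearIsometry.adjoint_comp_self he.orthogonalFamily.linearIsometry)
    exact this
  choose S hS using fun i : Fin d => exists_shift (Word.cons_injective i)
  -- Creation operators, carried to the copy of Fock space in `H` and zero on its complement.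
  let L : Fin d → (H →L[ℂ] H) := fun i => V ∘L S i ∘L V'
  obtain ⟨r, hr, hL⟩ : ∃ r : ℝ, 0 < r ∧ (r : ℂ) • L ∈ D := by
    have h1 : Filter.Tendsto (fun r : ℝ => (r : ℂ) • L) (𝓝 0) (𝓝 0) := by
      have : Continuous fun r : ℝ => (r : ℂ) • L := by fun_prop
      simpa using this.tendsto 0
    have h2 : ∀ᶠ r : ℝ in 𝓝[>] 0, (r : ℂ) • L ∈ D := nhdsWithin_le_nhds (h1 hD)
    obtain ⟨r, hr, hr'⟩ := (h2.and self_mem_nhdsWithin).exists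
    exact ⟨r, hr', hr⟩
  have hr0 : (r : ℂ) ≠ 0 := by exact_mod_cast hr.ne'
  -- The empty word indexes the vacuum vector.
  let e₀ : Word d := ⟨0, Fin.elim0⟩
  let ξ := V' (F ⟨_, hL⟩ (V (lp.single 2 e₀ 1)))
  -- This radius gives `d * (‖x‖ / r) < 1`; the `+ 1` covers `d = 0`.
  refine ⟨fun w => ξ w * ((r : ℂ) ^ w.1)⁻¹, r / (d + 1), by positivity, fun x hx => ?_⟩
  have hsum : Summable fun w : Word d => ‖((r : ℂ) ^ w.1)⁻¹ • Word.eval x.1 w‖ := by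
    have ht : (d : ℝ) * (‖x.1‖ / r) < 1 := by
      rw [lt_div_iff₀ (by positivity)] at hx
      rw [← mul_div_assoc, div_lt_one hr]
      nlinarith [norm_nonneg x.1]
    refine Summable.of_nonneg_of_le (fun _ => norm_nonneg _) (fun w => ?_)
      (Word.summable_pow (by positivity) ht)
    have : Nontrivial H := by
      by_contra h
      rw [not_nontrivial_iff_subsingleton] at h
      exact hH inferInstance
    rw [norm_smul, norm_inv, norm_pow, Complex.norm_real, Real.norm_of_nonneg hr.le, div_pow,
      div_eq_inv_mul]
    exact mul_le_mul_of_nonneg_left (Word.norm_eval_le _ _) (by positivity)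
  have hsumF : Summable fun w : Word d => (ξ w * ((r : ℂ) ^ w.1)⁻¹) • Word.eval x.1 w := by
    refine Summable.of_norm_bounded (hsum.mul_left ‖ξ‖) fun w => ?_
    rw [mul_smul, norm_smul]
    exact mul_le_mul_of_nonneg_right (lp.norm_apply_le_norm (by norm_num) ξ w) (norm_nonneg _)
  convert hsumF.hasSum using 1
  ext v
  obtain ⟨T, hT⟩ := exists_operator_of_summable (ι := Word d)
    (f := fun w => (((r : ℂ) ^ w.1)⁻¹ • Word.eval x.1 w) v)
    (Summable.of_nonneg_of_le (fun _ => norm_nonneg _)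
      (fun w => ContinuousLinearMap.le_opNorm _ v) (hsum.mul_right ‖v‖))
  have hTs : ∀ w c, T (lp.single 2 w c) = c • (((r : ℂ) ^ w.1)⁻¹ • Word.eval x.1 w) v :=
    fun w c => by
      refine (hT _).unique ?_
      convert hasSum_ite_eq w (c • (((r : ℂ) ^ w.1)⁻¹ • Word.eval x.1 w) v) using 2 with w'
      split_ifs with h
      · subst h; simp
      · simp [h]
  -- Prepending a letter multiplies the word by `x i` on the left and costs one factor `r⁻¹`.
  have hTS : ∀ i, (r : ℂ) • T ∘L S i = x.1 i ∘L T := fun i => by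
    refine lp.ext_continuousLinearMap (by norm_num) fun w => ?_
    ext
    have hc : (Word.cons i w).1 = w.1 + 1 := rfl
    simp only [ContinuousLinearMap.comp_apply, lp.singleContinuousLinearMap_apply, hS, hTs,
      Word.eval_cons, smul_apply, one_smul, mul_apply_eq_comp, map_smul, hc]
    rw [smul_smul, pow_succ, mul_inv, mul_comm, mul_assoc, inv_mul_cancel₀ hr0, mul_one]
  have hI := hF.map_intertwine ⟨_, hL⟩ x (T ∘L V') fun i => by
    ext v
    have := congrArg (fun A : lp (fun _ : Word d => ℂ) 2 →L[ℂ] H => A (V' v)) (hTS i)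
    simpa [L, hV] using this
  have h0 : T (lp.single 2 e₀ 1) = v := by
    rw [hTs]; simp [e₀, Word.eval]
  -- At the vacuum, which `T ∘L V'` sends to `v`, the intertwining relation reads `T ξ = F x v`.
  have h1 := congrArg (fun A : H →L[ℂ] H => A (V (lp.single 2 e₀ 1))) hI
  simp only [mul_apply_eq_comp, ContinuousLinearMap.comp_apply, hV, h0] at h1
  rw [← h1]
  refine (hT ξ).unique ?_
  simpa [mul_smul] using hsumF.hasSum.mapL (ContinuousLinearMap.apply ℂ H v)

end Fock

/-! ### Holomorphy along lines and global convergence -/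

section Holomorphy

variable {H : Type*} [NormedAddCommGroup H] [InnerProductSpace ℂ H] {d : ℕ}
  {D : Set (Fin d → (H →L[ℂ] H))}

/-- A bounded sequence with unbounded values would have a direct sum in `D`, where `map_directSum`
makes those values bounded. -/
theorem IntertwiningPreserving.exists_bound (hsum : ClosedUnderCountableDirectSums D)
    {F : D → (H →L[ℂ] H)} (hF : IntertwiningPreserving F) (R : ℝ) :
    ∃ M, ∀ x : D, ‖x.1‖ ≤ R → ‖F x‖ ≤ M := by
  by_contra! h
  choose x hx hFx using fun n : ℕ => h n
  have hR : 0 ≤ R := (norm_nonneg _).trans (hx 0)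
  have hb : ∀ i n, ‖(x n).1 i‖ ≤ R := fun i n => (norm_le_pi_norm _ i).trans (hx n)
  obtain ⟨u, hu⟩ := hsum x R hR hb
  obtain ⟨K, -, hK, -⟩ := hF.map_directSum ℕ x R hR hb _ ⟨_, hu⟩ fun i => rfl
  obtain ⟨n, hn⟩ := exists_nat_gt K
  exact ((hK n).trans_lt (hn.trans (hFx n))).false

/-- The upper triangular block tuples `(y, c; 0, z)`, completed by copies of `z`. -/
theorem exists_upperTriangular (hsum : ClosedUnderCountableDirectSums D) {z : Fin d → (H →L[ℂ] H)}
    (hz : z ∈ D) :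
    ∃ (Φ : (Fin d → (H →L[ℂ] H)) → (Fin d → (H →L[ℂ] H)) → (Fin d → (H →L[ℂ] H)))
      (P V : H →L[ℂ] H), Continuous (Function.uncurry Φ) ∧ Φ z 0 ∈ D ∧
      ∀ (F : D → (H →L[ℂ] H)), IntertwiningPreserving F → ∀ (y : D) (t : ℂ)
        (h : Φ y (t • (y.1 - z)) ∈ D), P * F ⟨_, h⟩ * V = t • (F y - F ⟨z, hz⟩) := by
  obtain ⟨u, hu⟩ := hsum (fun _ => ⟨z, hz⟩) ‖z‖ (norm_nonneg _) fun i _ => norm_le_pi_norm z i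
  set s := u.toContinuousLinearEquiv
  set w := fun i => conjDirectSum s (fun _ => z i) (norm_nonneg z) fun _ => norm_le_pi_norm z i
  have hw : ∀ i n, w i * summandOp s n = summandOp s n * z i := fun i n =>
    conjDirectSum_mul_summandOp _ _ _ _ _
  have h00 := coordOp_mul_summandOp_self s 0
  have h11 := coordOp_mul_summandOp_self s 1
  have h01 := coordOp_mul_summandOp_of_ne s zero_ne_one
  have h10 := coordOp_mul_summandOp_of_ne s one_ne_zero
  set V₀ := summandOp s 0
  set V₁ := summandOp s 1
  set P₀ := coordOp s 0
  set P₁ := coordOp s 1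
  -- The unitary is chosen for copies of `z` alone and stays fixed as `y` and `c` vary. Thus `Φ z 0`
  -- is in `D`, and openness of `D` reaches nearby block tuples.
  refine ⟨fun y c i => w i + V₀ * (y i - z i) * P₀ + V₀ * c i * P₁, P₀, V₁, ?_, ?_, ?_⟩
  · simp only [Function.uncurry_def]
    fun_prop
  · simpa using hu
  · intro F hF y t h
    -- For the corner `t • (y - z)`, `V₀` intertwines `y` with the block tuple and `V₁ - t • V₀`
    -- intertwines `z` with it. Combining the two relations for `F` gives its corner.
    have hc₀ : ∀ i, V₀ * y.1 i =
        (w i + V₀ * (y.1 i - z i) * P₀ + V₀ * (t • (y.1 - z)) i * P₁) * V₀ := fun i => by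
      rw [add_mul, add_mul, hw, mul_assoc _ P₀, h00, mul_assoc _ P₁, h10, mul_zero, mul_one,
        mul_sub]
      abel
    have hc₁ : ∀ i, (V₁ - t • V₀) * z i =
        (w i + V₀ * (y.1 i - z i) * P₀ + V₀ * (t • (y.1 - z)) i * P₁) * (V₁ - t • V₀) :=
        fun i => by
      have h2 : (w i + V₀ * (y.1 i - z i) * P₀ + V₀ * (t • (y.1 - z)) i * P₁) * V₁ =
          V₁ * z i + t • (V₀ * (y.1 i - z i)) := by
        rw [add_mul, add_mul, hw, mul_assoc _ P₀, h01, mul_assoc _ P₁, h11, mul_zero, mul_one,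
          add_zero, Pi.smul_apply, Pi.sub_apply, mul_smul_comm]
      rw [mul_sub, h2, mul_smul_comm, ← hc₀, sub_mul, smul_mul_assoc, mul_sub, smul_sub]
      abel
    have hF₀ := hF.map_intertwine y ⟨_, h⟩ V₀ hc₀
    have hF₁ := hF.map_intertwine ⟨z, hz⟩ ⟨_, h⟩ (V₁ - t • V₀) hc₁
    rw [mul_sub, mul_smul_comm, ← hF₀] at hF₁
    rw [mul_assoc, eq_add_of_sub_eq hF₁.symm, mul_add, ← mul_assoc, mul_sub, h01, mul_smul_comm,
      mul_smul_comm, h00, ← mul_assoc, h00, zero_sub, one_mul, neg_mul, smul_mul_assoc, one_mul,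
      smul_sub]
    abel

/-- The extension of `F` by zero outside its domain. -/
noncomputable def extendZero (F : D → (H →L[ℂ] H)) : (Fin d → (H →L[ℂ] H)) → (H →L[ℂ] H) :=
  Function.extend Subtype.val F 0

theorem extendZero_apply (F : D → (H →L[ℂ] H)) {x : Fin d → (H →L[ℂ] H)} (hx : x ∈ D) :
    extendZero F x = F ⟨x, hx⟩ :=
  Subtype.val_injective.extend_apply F 0 ⟨x, hx⟩

variable {F : D → (H →L[ℂ] H)}

/-- `F` is bounded near `Φ z 0`, so its corner `t • (F y - F z)` is bounded with `t` of order `1 /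
‖y - z‖`: a Lipschitz estimate at `z`. -/
theorem IntertwiningPreserving.continuousAt (hopen : IsOpen D)
    (hsum : ClosedUnderCountableDirectSums D) (hF : IntertwiningPreserving F)
    {z : Fin d → (H →L[ℂ] H)} (hz : z ∈ D) : ContinuousAt (extendZero F) z := by
  obtain ⟨Φ, P, V, hΦ, hΦD, hΦF⟩ := exists_upperTriangular hsum hz
  have h1 : ∀ᶠ q : (Fin d → (H →L[ℂ] H)) × (Fin d → (H →L[ℂ] H)) in 𝓝 (z, 0),
      Φ q.1 q.2 ∈ D ∧ ‖Φ q.1 q.2‖ < ‖Φ z 0‖ + 1 :=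
    Filter.Eventually.and (IsOpen.mem_nhds (x := (z, 0)) (hopen.preimage hΦ) hΦD)
      (IsOpen.mem_nhds (x := (z, 0)) (isOpen_lt hΦ.norm continuous_const) (lt_add_one ‖Φ z 0‖))
  obtain ⟨ε, hε, hball⟩ := Metric.eventually_nhds_iff.1 h1
  obtain ⟨M, hM⟩ := hF.exists_bound hsum (‖Φ z 0‖ + 1)
  have hlip : ∀ᶠ y in 𝓝 z, ‖extendZero F y - extendZero F z‖ ≤
      ‖P‖ * M * ‖V‖ * (2 / ε) * ‖y - z‖ := by
    filter_upwards [hopen.mem_nhds hz, Metric.ball_mem_nhds z hε] with y hy hyε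
    rcases eq_or_ne y z with rfl | hne
    · simp
    have hpos : 0 < ‖y - z‖ := norm_pos_iff.2 (sub_ne_zero.2 hne)
    -- Chosen so that the corner has norm `ε / 2`, inside the ball.
    set t : ℝ := ε / 2 / ‖y - z‖ with ht
    have ht0 : 0 < t := by positivity
    have hnt : ‖(t : ℂ) • (y - z)‖ < ε := by
      rw [norm_smul, Complex.norm_real, Real.norm_of_nonneg ht0.le, ht, div_mul_cancel₀ _ hpos.ne']
      linarith
    obtain ⟨hmem, hbd⟩ := hball (y := (y, (t : ℂ) • (y - z))) (by
      rw [Prod.dist_eq, max_lt_iff]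
      exact ⟨hyε, by simpa using hnt⟩)
    have h2 := hΦF F hF ⟨y, hy⟩ t hmem
    have h3 := hM ⟨_, hmem⟩ hbd.le
    rw [extendZero_apply F hy, extendZero_apply F hz]
    have h4 : t * ‖F ⟨y, hy⟩ - F ⟨z, hz⟩‖ ≤ ‖P‖ * M * ‖V‖ := by
      have h5 : t * ‖F ⟨y, hy⟩ - F ⟨z, hz⟩‖ = ‖(t : ℂ) • (F ⟨y, hy⟩ - F ⟨z, hz⟩)‖ := by
        rw [norm_smul, Complex.norm_real, Real.norm_of_nonneg ht0.le]
      rw [h5, ← h2]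
      refine (norm_mul_le _ _).trans (mul_le_mul_of_nonneg_right ?_ (norm_nonneg _))
      exact (norm_mul_le _ _).trans (mul_le_mul_of_nonneg_left h3 (norm_nonneg _))
    have h6 : 2 / ε * ‖y - z‖ * t = 1 := by
      rw [ht]
      field_simp
    calc ‖F ⟨y, hy⟩ - F ⟨z, hz⟩‖ = 2 / ε * ‖y - z‖ * (t * ‖F ⟨y, hy⟩ - F ⟨z, hz⟩‖) := by
          rw [← mul_assoc, h6, one_mul]
      _ ≤ 2 / ε * ‖y - z‖ * (‖P‖ * M * ‖V‖) := by gcongr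
      _ = _ := by ring
  rw [ContinuousAt, tendsto_iff_norm_sub_tendsto_zero]
  refine squeeze_zero' (Filter.Eventually.of_forall fun _ => norm_nonneg _) hlip ?_
  have h7 : Continuous fun y => ‖P‖ * M * ‖V‖ * (2 / ε) * ‖y - z‖ := by fun_prop
  simpa using h7.tendsto z

/-- With the corner held at `ε • x`, that is `t = ε / (ζ - l)`, the difference quotient is `ε⁻¹`
times the corner of `F` at a block tuple continuous in `ζ`. Continuity of `F` then supplies the
limit. -/
theorem IntertwiningPreserving.differentiableAt (hopen : IsOpen D)
    (hsum : ClosedUnderCountableDirectSums D) (hF : IntertwiningPreserving F)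
    {x : Fin d → (H →L[ℂ] H)} {l : ℂ} (hx : l • x ∈ D) :
    DifferentiableAt ℂ (fun ζ : ℂ => extendZero F (ζ • x)) l := by
  obtain ⟨Φ, P, V, hΦ, hΦD, hΦF⟩ := exists_upperTriangular hsum hx
  obtain ⟨ε, hε, hεD⟩ : ∃ ε : ℂ, ε ≠ 0 ∧ Φ (l • x) (ε • x) ∈ D := by
    have h1 : Continuous fun ε : ℂ => Φ (l • x) (ε • x) :=
      hΦ.comp (f := fun ε : ℂ => (l • x, ε • x)) (by fun_prop)
    have h2 : ∀ᶠ ε : ℂ in 𝓝[≠] 0, Φ (l • x) (ε • x) ∈ D :=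
      nhdsWithin_le_nhds (h1.continuousAt.eventually (hopen.mem_nhds (by simpa using hΦD)))
    obtain ⟨ε, h, h'⟩ := (h2.and self_mem_nhdsWithin).exists
    exact ⟨ε, h', h⟩
  have hΨ : Continuous fun ζ : ℂ => Φ (ζ • x) (ε • x) :=
    hΦ.comp (f := fun ζ : ℂ => (ζ • x, ε • x)) (by fun_prop)
  have hlim : ContinuousAt (fun ζ : ℂ => ε⁻¹ • (P * extendZero F (Φ (ζ • x) (ε • x)) * V)) l := by
    have h1 : ContinuousAt (fun ζ : ℂ => extendZero F (Φ (ζ • x) (ε • x))) l :=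
      ContinuousAt.comp (f := fun ζ : ℂ => Φ (ζ • x) (ε • x))
        (hF.continuousAt hopen hsum hεD) hΨ.continuousAt
    exact ContinuousAt.const_smul ((continuousAt_const.mul h1).mul continuousAt_const) ε⁻¹
  refine HasDerivAt.differentiableAt (f' := ε⁻¹ • (P * extendZero F (Φ (l • x) (ε • x)) * V)) ?_
  rw [hasDerivAt_iff_tendsto_slope]
  refine (hlim.tendsto.mono_left nhdsWithin_le_nhds).congr' ?_
  have hxc : Continuous fun ζ : ℂ => ζ • x := by fun_prop
  filter_upwards [nhdsWithin_le_nhds (hΨ.continuousAt.eventually (hopen.mem_nhds hεD)),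
    nhdsWithin_le_nhds (hxc.continuousAt.eventually (hopen.mem_nhds hx)),
    self_mem_nhdsWithin] with ζ hζ hζx hne
  have hne' : ζ - l ≠ 0 := sub_ne_zero.2 hne
  have hc : ε • x = (ε / (ζ - l)) • (ζ • x - l • x) := by
    rw [← sub_smul, smul_smul, div_mul_cancel₀ _ hne']
  have h3 : Φ (ζ • x) ((ε / (ζ - l)) • (ζ • x - l • x)) ∈ D := hc ▸ hζ
  have h2 := hΦF F hF ⟨_, hζx⟩ _ h3
  rw [slope_def_module, extendZero_apply F hζx, extendZero_apply F hx, hc, extendZero_apply F h3,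
    h2, smul_smul, ← mul_div_assoc, inv_mul_cancel₀ hε, one_div]

theorem IntertwiningPreserving.hasFreePowerSeries [CompleteSpace H] (hH : ¬ FiniteDimensional ℂ H)
    (hbal : Balanced ℂ D) (hopen : IsOpen D) (hsum : ClosedUnderCountableDirectSums D)
    (hF : IntertwiningPreserving F) : HasFreePowerSeries F := by
  rcases D.eq_empty_or_nonempty with rfl | hne
  · exact ⟨fun _ => 0, fun k => Submodule.zero_mem _, fun x => x.2.elim⟩
  have h0 : D ∈ 𝓝 0 := hopen.mem_nhds (hbal.zero_mem hne)
  obtain ⟨a, ρ, hρ, ha⟩ := hF.exists_coeff hH h0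
  refine ⟨FreePoly.ofCoeff a, FreePoly.isHomogeneousOfDegree_ofCoeff a, fun x => ?_⟩
  have hxc : Continuous fun ζ : ℂ => ζ • x.1 := by fun_prop
  -- `R > 1` puts `ζ = 1` inside the open disc of convergence; balancedness keeps the closed disc of
  -- multiples of `x` in `D`.
  obtain ⟨R, hR, hRx⟩ : ∃ R : ℝ, 1 < R ∧ (R : ℂ) • x.1 ∈ D := by
    have h1 : Continuous fun R : ℝ => (R : ℂ) • x.1 := by fun_prop
    have h2 : ∀ᶠ R : ℝ in 𝓝[>] 1, (R : ℂ) • x.1 ∈ D :=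
      nhdsWithin_le_nhds (h1.continuousAt.eventually (hopen.mem_nhds (by simp)))
    obtain ⟨R, h, h'⟩ := (h2.and self_mem_nhdsWithin).exists
    exact ⟨R, h', h⟩
  lift R to NNReal using by linarith
  have hR1 : 1 < R := by exact_mod_cast hR
  have hdiff : DifferentiableOn ℂ (fun ζ : ℂ => extendZero F (ζ • x.1)) (Metric.closedBall 0 R) :=
    fun ζ hζ => (hF.differentiableAt hopen hsum (hbal.smul_mem_mono hRx (by simpa using hζ))
      ).differentiableWithinAt
  have hser := hdiff.hasFPowerSeriesOnBall (by positivity)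
  let q : FormalMultilinearSeries ℂ ℂ (H →L[ℂ] H) := fun k =>
    ContinuousMultilinearMap.mkPiRing ℂ (Fin k) ((FreePoly.ofCoeff a k).evalOp x.1)
  have hq : HasFPowerSeriesAt (fun ζ : ℂ => extendZero F (ζ • x.1)) q 0 := by
    rw [hasFPowerSeriesAt_iff']
    have h1 : ∀ᶠ ζ : ℂ in 𝓝 0, ‖ζ • x.1‖ < ρ :=
      hxc.norm.continuousAt.eventually (gt_mem_nhds (by simpa using hρ))
    have h2 : ∀ᶠ ζ : ℂ in 𝓝 0, ζ • x.1 ∈ D := hxc.continuousAt (by simpa using h0)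
    filter_upwards [h1, h2] with ζ hζ hζD
    rw [extendZero_apply F hζD]
    have h3 : HasSum (fun k => (FreePoly.ofCoeff a k).evalOp (ζ • x.1)) (F ⟨_, hζD⟩) := by
      simp only [FreePoly.evalOp_ofCoeff]
      exact HasSum.sigma (ha ⟨_, hζD⟩ hζ) fun k => hasSum_fintype _
    simpa [q, FormalMultilinearSeries.coeff, FreePoly.evalOp_ofCoeff_smul] using h3
  -- The Cauchy series on the large disc and the free series near `0` agree by uniqueness.
  rw [hser.hasFPowerSeriesAt.eq_formalMultilinearSeries hq] at hser
  have h1 : (1 : ℂ) ∈ Metric.eball (0 : ℂ) R := by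
    simpa [Metric.mem_eball, edist_eq_enorm_sub] using hR1
  have h2 : ∀ k, (q k fun _ => 1) = (FreePoly.ofCoeff a k).evalOp x.1 := fun k => by
    simp [q]
  have h3 := hser.hasSum h1
  have h4 := q.summable_norm_apply (x := 1) (Metric.eball_subset_eball hser.r_le h1)
  simp only [h2, zero_add, one_smul, extendZero_apply F x.2] at h3 h4
  exact ⟨h4, h3⟩

end Holomorphy

end FreeIP

theorem mainTheorem1 {H : Type*} [NormedAddCommGroup H] [InnerProductSpace ℂ H] [CompleteSpace H]
    [TopologicalSpace.SeparableSpace H] (hH : ¬ FiniteDimensional ℂ H)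
    {d : ℕ} (D : Set (Fin d → (H →L[ℂ] H)))
    (hbal : Balanced ℂ D) (hopen : IsOpen D)
    (hsum : FreeIP.ClosedUnderCountableDirectSums D)
    (F : D → (H →L[ℂ] H)) :
    List.TFAE [
      FreeIP.IntertwiningPreserving F ∧ FreeIP.SeqStrongOperatorContinuous F,
      FreeIP.HasFreePowerSeries F,
      FreeIP.ApproximableOnFiniteSets F] := by
  tfae_have 1 → 2 := fun h => h.1.hasFreePowerSeries hH hbal hopen hsum
  tfae_have 2 → 3 := fun h => h.approximableOnFiniteSets
  tfae_have 3 → 1 := fun h =>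
    ⟨.of_map_intertwine h.map_intertwine, h.seqStrongOperatorContinuous hsum⟩
  tfae_finish
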